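/- Let $(R,\mathfrak m,k)$ be a complete Noetherian Cohen--Macaulay local ring of Krull dimension $d$. A closure operation $\mathrm{cl}$ on $R$-modules assigns to each inclusion of $R$-modules $N\subseteq M$ a submodule $N_M^{\mathrm{cl}}\subseteq M$ with $N\subseteq N_M^{\mathrm{cl}}$, $(N_M^{\mathrm{cl}})_M^{\mathrm{cl}}=N_M^{\mathrm{cl}}$, and $N_M^{\mathrm{cl}}\subseteq (N')_M^{\mathrm{cl}}$ whenever $N\subseteq N'\subseteq M$. For an ideal $I$ write $I^{\mathrm{cl}}=I_R^{\mathrm{cl}}$; $I$ is $\mathrm{cl}$-closed if $I^{\mathrm{cl}}=I$. A system of parameters is a sequence $x_1,\dots,x_d\in\mathfrak m$ of length $d$ generating an $\mathfrak m$-primary ideal; a partial system of parameters is a sequence that extends to a system of parameters. Let $\mathrm{cl}$ be a closure operation on $R$-modules that is * functorial: $f(L_M^{\mathrm{cl}})\subseteq f(L)_N^{\mathrm{cl}}$ for every $R$-linear map $f:M\to N$ and every $L\subseteq M$; * residual: $N_M^{\mathrm{cl}}=\pi^{-1}\big((N/L)_{M/L}^{\mathrm{cl}}\big)$ for all $L\subseteq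 N\subseteq M$, where $\pi:M\to M/L$ is the natural surjection; and that satisfies * colon-capturing: $(x_1,\dots,x_k):_R x_{k+1}\subseteq (x_1,\dots,x_k)^{\mathrm{cl}}$ for every partial system of parameters $x_1,\dots,x_{k+1}$; * strong colon-capturing, version A: $(x_1^t,x_2,\dots,x_k)^{\mathrm{cl}}:_R x_1^a\subseteq (x_1^{t-a},x_2,\dots,x_k)^{\mathrm{cl}}$ for every partial system of parameters $x_1,\dots,x_k$ with $k\ge 1$ and all integers $0\le a<t$. If the ideal generated by some one system of parameters of $R$ is $\mathrm{cl}$-closed, then every ideal generated by a system of parameters of $R$ is $\mathrm{cl}$-closed. Suppose in addition that $\mathrm{cl}$ satisfies the injective finiteness condition: with $H=H^d_{\mathfrak m}(R)$, the closure $0_H^{\mathrm{cl}}$ is equal to $\bigcup_N 0_N^{\mathrm{cl}}$, the union being over all finitely generated submodules $N\subseteq H$. Then $R$ is $\mathrm{cl}$-rational, that is, $\tau_{\mathrm{cl}}(\omega)=\omega$. Here $E=E_R(k)$ is the injective hull of $k$, $\omega=\operatorname{Hom}_R(H,E)$ is the canonical module of $R$, and $\tau_{\mathrm{cl}}(\omega)=\operatorname{Ann}_\omega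 0_H^{\mathrm{cl}}=\{f\in\omega : f(0_H^{\mathrm{cl}})=0\}$. -/

import Mathlib

open IsLocalRing

universe u

/-! ### Closure operations on modules -/

/-- A closure operation on the category of all `R`-modules:
`cl N` is the closure of the submodule `N` of `M` inside `M`. -/
structure ModuleClosure (R : Type u) [CommRing R] where
  /-- The closure of a submodule `N` of `M` inside `M`. -/
  cl : ∀ {M : Type u} [AddCommGroup M] [Module R M], Submodule R M → Submodule R M
  le_cl : ∀ {M : Type u} [AddCommGroup M] [Module R M] (N : Submodule R M), N ≤ cl N
  cl_cl : ∀ {M : Type u} [AddCommGroup M] [Module R M] (N : Submodule R M), cl (cl N) = cl N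
  cl_mono : ∀ {M : Type u} [AddCommGroup M] [Module R M] (N N' : Submodule R M),
    N ≤ N' → cl N ≤ cl N'

namespace ModuleClosure

variable {R : Type u} [CommRing R]

/-- `f (L_M^cl) ⊆ (f L)_N^cl` for every `R`-linear map `f : M → N` and every `L ⊆ M`. -/
def IsFunctorial (c : ModuleClosure R) : Prop :=
  ∀ (M N : Type u) [AddCommGroup M] [Module R M] [AddCommGroup N] [Module R N]
    (f : M →ₗ[R] N) (L : Submodule R M), (c.cl L).map f ≤ c.cl (L.map f)

/-- `N_M^cl = π⁻¹ ((N/L)_{M/L}^cl)` for all `L ⊆ N ⊆ M`, where `π : M → M/L` is the surjection. -/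
def IsResidual (c : ModuleClosure R) : Prop :=
  ∀ (M : Type u) [AddCommGroup M] [Module R M] (L N : Submodule R M), L ≤ N →
    c.cl N = (c.cl (N.map L.mkQ)).comap L.mkQ

/-- The finitistic version of the closure: the union of the `L_N^cl` over all `L ⊆ N ⊆ M` with
`N/L` finitely generated, as a subset of `M`. -/
def finitistic (c : ModuleClosure R) {M : Type u} [AddCommGroup M] [Module R M]
    (L : Submodule R M) : Set M :=
  {x | ∃ N : Submodule R M, L ≤ N ∧ Module.Finite R (N ⧸ L.submoduleOf N) ∧
    x ∈ (c.cl (L.submoduleOf N)).map N.subtype}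

/-- The ideal `I` is closed in `R`. -/
def IsClosedIdeal (c : ModuleClosure R) (I : Ideal R) : Prop := c.cl (M := R) I = I

end ModuleClosure

/-! ### Systems of parameters and Cohen-Macaulay local rings -/

section LocalRings

variable {R : Type u} [CommRing R] [IsLocalRing R]

/-- `x₁, …, x_d` is a (full) system of parameters of the local ring `R`: `d = dim R` and
`(x₁, …, x_d)` is primary to the maximal ideal. -/
def IsSystemOfParameters {d : ℕ} (x : Fin d → R) : Prop :=
  ringKrullDim R = d ∧ (Ideal.span (Set.range x)).radical = maximalIdeal R

/-- `x₁, …, x_k` is a partial system of parameters: it extends to a full one. -/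
def IsPartialSystemOfParameters {k : ℕ} (x : Fin k → R) : Prop :=
  ∃ (d : ℕ) (h : k ≤ d) (y : Fin d → R),
    IsSystemOfParameters y ∧ ∀ i, y (Fin.castLE h i) = x i

variable (R) in
/-- A Noetherian local ring is Cohen-Macaulay if it has a regular sequence of length `dim R`
(that is, its depth is its dimension); a regular sequence in the sense of `IsRegular` generates a
proper ideal, so it lies in the maximal ideal. -/
def IsCohenMacaulayLocal : Prop :=
  ∃ rs : List R, RingTheory.Sequence.IsRegular R rs ∧ ringKrullDim R = rs.length

/-- Colon-capturing: `(x₁, …, x_k) : x_{k+1} ⊆ (x₁, …, x_k)^cl` for every partial system of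
parameters `x₁, …, x_{k+1}`. -/
def ModuleClosure.ColonCapturing (c : ModuleClosure R) : Prop :=
  ∀ (k : ℕ) (x : Fin (k + 1) → R), IsPartialSystemOfParameters x →
    (Ideal.span (Set.range fun i : Fin k => x i.castSucc)).colon {x (Fin.last k)} ≤
      c.cl (M := R) (Ideal.span (Set.range fun i : Fin k => x i.castSucc))

/-- Strong colon-capturing, version A:
`(x₁ᵗ, x₂, …, x_k)^cl : x₁ᵃ ⊆ (x₁ᵗ⁻ᵃ, x₂, …, x_k)^cl` for every (nonempty) partial system of
parameters `x₁, …, x_k` and all `0 ≤ a < t`. -/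
def ModuleClosure.StrongColonCapturingA (c : ModuleClosure R) : Prop :=
  ∀ (k : ℕ) (x : Fin (k + 1) → R), IsPartialSystemOfParameters x → ∀ a t : ℕ, a < t →
    (c.cl (M := R) (Ideal.span (Set.range (Function.update x 0 (x 0 ^ t))))).colon {x 0 ^ a} ≤
      c.cl (M := R) (Ideal.span (Set.range (Function.update x 0 (x 0 ^ (t - a)))))

end LocalRings

/-! ### Injective hulls -/

section InjectiveHull

variable {R : Type u} [CommRing R]

/-- `ι : K → E` is an injective hull of `K`: `E` is injective and `ι` is an essential
monomorphism. -/
structure IsInjectiveHull {K E : Type u} [AddCommGroup K] [Module R K] [AddCommGroup E]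
    [Module R E] (ι : K →ₗ[R] E) : Prop where
  injective_module : Module.Injective R E
  injective : Function.Injective ι
  essential : ∀ N : Submodule R E, N ⊓ LinearMap.range ι = ⊥ → N = ⊥

/-- Every module has an injective hull. -/
theorem exists_isInjectiveHull (K : Type u) [AddCommGroup K] [Module R K] :
    ∃ (E : ModuleCat.{u} R) (ι : K →ₗ[R] E), IsInjectiveHull ι := by
  obtain ⟨I, hI, j, hj⟩ : ∃ (I : ModuleCat.{u} R) (_ : Module.Injective R I) (j : K →ₗ[R] I),
      Function.Injective j := by
    have h : CategoryTheory.Injective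
        (CategoryTheory.Injective.under (ModuleCat.of R K)) := inferInstance
    refine ⟨CategoryTheory.Injective.under (ModuleCat.of R K),
      Module.injective_module_of_injective_object (inj := h) R _,
      (CategoryTheory.Injective.ι (ModuleCat.of R K)).hom, ?_⟩
    exact (ModuleCat.mono_iff_injective _).1 inferInstance
  -- a maximal essential extension `E` of `K` inside `I`
  obtain ⟨E, -, hE⟩ := zorn_le_nonempty₀
    {N : Submodule R I | LinearMap.range j ≤ N ∧
      ∀ L ≤ N, L ⊓ LinearMap.range j = ⊥ → L = ⊥}
    (by
      intro c hc hchain N₀ hN₀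
      refine ⟨sSup c, ⟨(hc hN₀).1.trans (le_sSup hN₀), ?_⟩, fun N hN => le_sSup hN⟩
      intro L hL hLj
      rw [eq_bot_iff]
      intro x hx
      obtain ⟨N, hN, hxN⟩ := (Submodule.mem_sSup_of_directed ⟨N₀, hN₀⟩ hchain.directedOn).1 (hL hx)
      have h1 : Submodule.span R {x} = ⊥ := by
        refine (hc hN).2 _ (by simpa using hxN) ?_
        rw [eq_bot_iff, ← hLj]
        exact inf_le_inf_right _ (by simpa using hx)
      simpa using h1)
    (LinearMap.range j) ⟨le_rfl, fun L hL h => by rwa [inf_eq_left.2 hL] at h⟩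
  -- a maximal submodule `Q` of `I` with `Q ⊓ E = ⊥`
  obtain ⟨Q, -, hQ⟩ := zorn_le_nonempty₀ {Q : Submodule R I | Q ⊓ E = ⊥}
    (by
      intro c hc hchain N₀ hN₀
      refine ⟨sSup c, ?_, fun N hN => le_sSup hN⟩
      change sSup c ⊓ E = ⊥
      rw [eq_bot_iff]
      rintro x ⟨hx, hxE⟩
      obtain ⟨N, hN, hxN⟩ := (Submodule.mem_sSup_of_directed ⟨N₀, hN₀⟩ hchain.directedOn).1 hx
      have h1 : N ⊓ E = ⊥ := hc hN
      rw [← h1]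
      exact ⟨hxN, hxE⟩)
    ⊥ (by simp)
  have hQE : Q ⊓ E = ⊥ := hQ.prop
  let f : E →ₗ[R] I ⧸ Q := Q.mkQ ∘ₗ E.subtype
  have hf : Function.Injective f := by
    rw [← LinearMap.ker_eq_bot, eq_bot_iff]
    rintro ⟨x, hx⟩ hx0
    have hxQ : x ∈ Q := by simpa [f] using hx0
    have : x ∈ Q ⊓ E := ⟨hxQ, hx⟩
    rw [hQE] at this
    simpa using this
  have hess : ∀ P : Submodule R (I ⧸ Q), P ⊓ LinearMap.range f = ⊥ → P = ⊥ := by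
    intro P hP
    have h1 : P.comap Q.mkQ ⊓ E = ⊥ := by
      rw [eq_bot_iff]
      rintro x ⟨hx, hxE⟩
      have h2 : Q.mkQ x ∈ P ⊓ LinearMap.range f := ⟨hx, ⟨⟨x, hxE⟩, rfl⟩⟩
      rw [hP, Submodule.mem_bot] at h2
      have h3 : x ∈ Q ⊓ E := ⟨by simpa using h2, hxE⟩
      rwa [hQE] at h3
    have h4 : P.comap Q.mkQ ≤ Q := hQ.le_of_ge h1 (Submodule.le_comap_mkQ Q P)
    rw [eq_bot_iff]
    intro p hp
    obtain ⟨x, rfl⟩ := Q.mkQ_surjective p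
    simpa using h4 hp
  obtain ⟨g, hg⟩ := hI.out f hf E.subtype
  have hginj : LinearMap.ker g = ⊥ := by
    refine hess _ ?_
    rw [eq_bot_iff]
    rintro _ ⟨hx, e, rfl⟩
    have h1 : (e : I) = 0 := by
      have := hg e
      rw [LinearMap.mem_ker.1 hx] at this
      simpa using this.symm
    have h2 : e = 0 := Subtype.ext h1
    simp [h2]
  have hEg : E ≤ LinearMap.range g := fun x hx => ⟨f ⟨x, hx⟩, hg ⟨x, hx⟩⟩
  have hgE : LinearMap.range g ≤ E := by
    refine hE.le_of_ge ⟨hE.prop.1.trans hEg, ?_⟩ hEg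
    intro L hL hLj
    have h1 : L ⊓ E = ⊥ := by
      refine hE.prop.2 _ inf_le_right ?_
      rw [eq_bot_iff, ← hLj]
      exact inf_le_inf_right _ inf_le_left
    have h2 : L.comap g = ⊥ := by
      refine hess _ ?_
      rw [eq_bot_iff]
      rintro _ ⟨hx, e, rfl⟩
      have h3 : (e : I) ∈ L ⊓ E := by
        refine ⟨?_, e.2⟩
        have : g (f e) ∈ L := hx
        rwa [hg e] at this
      rw [h1] at h3
      have h4 : e = 0 := Subtype.ext (by simpa using h3)
      simp [h4]
    rw [eq_bot_iff]
    intro x hx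
    obtain ⟨y, rfl⟩ := hL hx
    have : y ∈ L.comap g := hx
    rw [h2, Submodule.mem_bot] at this
    simp [this]
  let r : I →ₗ[R] E := (g ∘ₗ Q.mkQ).codRestrict E fun x => hgE ⟨_, rfl⟩
  have hr : ∀ e : E, r e = e := fun e => Subtype.ext (hg e)
  refine ⟨ModuleCat.of R E, j.codRestrict E fun x => hE.prop.1 ⟨x, rfl⟩, ⟨⟨?_⟩, ?_, ?_⟩⟩
  · intro X Y _ _ _ _ i hi h
    obtain ⟨h', hh'⟩ := hI.out i hi (E.subtype ∘ₗ h)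
    refine ⟨r ∘ₗ h', fun x => ?_⟩
    have : h' (i x) = (h x : I) := hh' x
    simpa [this] using hr (h x)
  · intro x y hxy
    exact hj (congrArg Subtype.val hxy)
  · intro N hN
    have h1 : N.map E.subtype = ⊥ := by
      refine hE.prop.2 _ (Submodule.map_subtype_le E N) ?_
      rw [eq_bot_iff]
      rintro _ ⟨⟨e, he, rfl⟩, k, hk⟩
      have h2 : e ∈ N ⊓ LinearMap.range (j.codRestrict E fun x => hE.prop.1 ⟨x, rfl⟩) :=
        ⟨he, k, Subtype.ext hk⟩
      have h3 : e = 0 := by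
        have h4 := hN.le h2
        exact (Submodule.mem_bot R).1 h4
      simp [h3]
    exact Submodule.map_injective_of_injective E.injective_subtype
      (h1.trans (Submodule.map_bot _).symm)

variable (R) in
/-- The injective hull `E = E_R(k)` of the residue field `k` of `R` (unique up to isomorphism). -/
noncomputable def residueFieldInjectiveHull [IsLocalRing R] : ModuleCat.{u} R :=
  (exists_isInjectiveHull (R := R) (ResidueField R)).choose

end InjectiveHull

/-! ### Top local cohomology, the canonical module and cl-rationality -/

section Rationality

variable (R : Type u) [CommRing R] [IsLocalRing R]

/-- The Krull dimension `d` of a Noetherian local ring, as a natural number. -/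
noncomputable def localDim : ℕ := ((ringKrullDim R).unbotD 0).toNat

/-- The top local cohomology module `H_𝔪^d(R)`, where `d = dim R`. -/
noncomputable def topLocalCohomology : ModuleCat.{u} R :=
  (localCohomology (maximalIdeal R) (localDim R)).obj (ModuleCat.of R R)

/-- The canonical module `ω` of a complete Cohen-Macaulay local ring: the Matlis dual
`Hom_R(H_𝔪^d(R), E)` of the top local cohomology module. -/
abbrev canonicalModule : Type u := topLocalCohomology R →ₗ[R] residueFieldInjectiveHull R

variable {R}

/-- `τ_cl(ω) = Ann_ω (0^cl)`, the submodule of those `f ∈ ω = Hom_R(H_𝔪^d(R), E)` that vanish on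
the closure of `0` in `H_𝔪^d(R)`. -/
noncomputable def ModuleClosure.tauCanonical (c : ModuleClosure R) :
    Submodule R (canonicalModule R) where
  carrier := {f | ∀ h ∈ c.cl (⊥ : Submodule R (topLocalCohomology R)), f h = 0}
  add_mem' hf hg h hh := by rw [LinearMap.add_apply, hf h hh, hg h hh, add_zero]
  zero_mem' h _ := LinearMap.zero_apply h
  smul_mem' r f hf h hh := by rw [LinearMap.smul_apply, hf h hh, smul_zero]

/-- `R` is cl-rational: `τ_cl(ω) = ω`. -/
def ModuleClosure.IsRational (c : ModuleClosure R) : Prop := c.tauCanonical = ⊤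

/-- The injective finiteness condition: the closure of `0` in `H_𝔪^d(R)` agrees with its
finitistic closure. -/
def ModuleClosure.InjectiveFiniteness (c : ModuleClosure R) : Prop :=
  (c.cl (⊥ : Submodule R (topLocalCohomology R)) : Set (topLocalCohomology R)) =
    c.finitistic (⊥ : Submodule R (topLocalCohomology R))

end Rationality

/-! First assertion. Let `(a, f)` be a closed parameter ideal, `f` being the remaining parameters.
Strong colon-capturing makes every `(a ^ t, f)` closed. If `w` completes `f` to a system of
parameters, colon-capturing gives `(f) : w ⊆ (f)^cl ⊆ ⋂ (a ^ t, f)`, and by Krull's intersection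
theorem this is `(f)`; so `w` is regular modulo `f`. If `z` also completes `f`, write `a ^ s = w z +
i` with `i ∈ (f)`. Multiplication by `w` sends `(z, f)` into the closed ideal `(a ^ s, f)`, so by
functoriality it sends `(z, f)^cl` there too, and cancelling `w` modulo `f` shows that `(z, f)` is
closed (`isClosedIdeal_cons_exchange`). Prime avoidance joins any two systems of parameters by such
one-element exchanges.

Second assertion. The same intersection argument now makes every system of parameters a regular
sequence. The module `H` is the colimit of `Ext^d(R/𝔪^t, R)`. If a system of parameters `y` lies in
`𝔪^t`, Rees' dimension shift along `y` embeds `Ext^d(R/𝔪^t, R)` into `Hom(R/𝔪^t, R/(y))`, hence into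
`R/(y)`; it also makes the transition maps injective. So each finitely generated `N ⊆ H` embeds into
some `R/(y)`, where zero is closed by residuality, and functoriality gives `0_N^cl = 0`. Injective
finiteness then yields `0_H^cl = 0`, whose annihilator is all of `ω`. -/

/-! ### Systems of parameters: exchange and prime avoidance. -/

section SystemsOfParameters

variable {R : Type u} [CommRing R] [IsLocalRing R]

/-- An element of an ideal modulo every power of the maximal ideal lies in the ideal. -/
theorem mem_of_forall_mem_sup_maximalIdeal_pow [IsNoetherianRing R] {I : Ideal R} {u : R}
    (h : ∀ t : ℕ, u ∈ I ⊔ maximalIdeal R ^ t) : u ∈ I := by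
  -- Krull's intersection theorem for the module `R ⧸ I`.
  have hbot := (maximalIdeal R).iInf_pow_smul_eq_bot_of_isLocalRing (M := R ⧸ I)
    (Ideal.IsPrime.ne_top inferInstance)
  have hmem : Ideal.Quotient.mk I u ∈
      (⨅ i : ℕ, maximalIdeal R ^ i • ⊤ : Submodule R (R ⧸ I)) := by
    rw [Submodule.mem_iInf]
    intro t
    obtain ⟨a, ha, b, hb, rfl⟩ := Submodule.mem_sup.1 (h t)
    have h1 : Ideal.Quotient.mk I (a + b) = b • (1 : R ⧸ I) := by
      rw [map_add, Ideal.Quotient.eq_zero_iff_mem.2 ha, zero_add, Algebra.smul_def, mul_one]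
      rfl
    rw [h1]
    exact Submodule.smul_mem_smul hb trivial
  rw [hbot, Submodule.mem_bot] at hmem
  exact Ideal.Quotient.eq_zero_iff_mem.1 hmem

namespace IsSystemOfParameters

variable {d n : ℕ}

theorem mem_maximalIdeal {x : Fin d → R} (hx : IsSystemOfParameters x) (i : Fin d) :
    x i ∈ maximalIdeal R := by
  rw [← hx.2]
  exact Ideal.le_radical (Ideal.subset_span ⟨i, rfl⟩)

theorem span_le {x : Fin d → R} (hx : IsSystemOfParameters x) :
    Ideal.span (Set.range x) ≤ maximalIdeal R := by
  rw [← hx.2]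
  exact Ideal.le_radical

theorem of_mem_radical {x y : Fin d → R} (hx : IsSystemOfParameters x)
    (hy : ∀ i, y i ∈ maximalIdeal R)
    (hxy : ∀ i, x i ∈ (Ideal.span (Set.range y)).radical) : IsSystemOfParameters y := by
  refine ⟨hx.1, le_antisymm ?_ ?_⟩
  · refine ((Ideal.IsPrime.isRadical inferInstance).radical_le_iff).2 (Ideal.span_le.2 ?_)
    rintro _ ⟨i, rfl⟩
    exact hy i
  · rw [← hx.2, Ideal.radical_le_radical_iff, Ideal.span_le]
    rintro _ ⟨i, rfl⟩
    exact hxy i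

theorem of_range_eq {x y : Fin d → R} (hx : IsSystemOfParameters x)
    (h : Set.range y = Set.range x) : IsSystemOfParameters y :=
  ⟨hx.1, by rw [h, hx.2]⟩

theorem pow {x : Fin d → R} (hx : IsSystemOfParameters x) (e : Fin d → ℕ) (he : ∀ i, e i ≠ 0) :
    IsSystemOfParameters fun i => x i ^ e i :=
  hx.of_mem_radical (fun i => Ideal.pow_mem_of_mem _ (hx.mem_maximalIdeal i) _
    (Nat.pos_of_ne_zero (he i))) fun i => ⟨e i, Ideal.subset_span ⟨i, rfl⟩⟩

theorem isPartial {x : Fin d → R} (hx : IsSystemOfParameters x) :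
    IsPartialSystemOfParameters x :=
  ⟨d, le_rfl, x, hx, fun _ => rfl⟩

theorem cons_pow {a : R} {f : Fin n → R}
    (h : IsSystemOfParameters (Fin.cons a f : Fin (n + 1) → R)) {t : ℕ} (ht : t ≠ 0) :
    IsSystemOfParameters (Fin.cons (a ^ t) f : Fin (n + 1) → R) := by
  refine (h.pow (Fin.cons t fun _ => 1) (Fin.cases ht fun _ => one_ne_zero)).of_range_eq ?_
  congr 1
  ext i
  refine Fin.cases ?_ (fun j => ?_) i <;> simp

/-- The maximal ideal is not minimal over an ideal with fewer generators than the dimension. -/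
theorem maximalIdeal_notMem_minimalPrimes [IsNoetherianRing R]
    {x : Fin (n + 1) → R} (hx : IsSystemOfParameters x) (f : Fin n → R) :
    maximalIdeal R ∉ (Ideal.span (Set.range f)).minimalPrimes := by
  intro h
  -- Krull's height theorem would bound the dimension `n + 1` by `n`.
  have h1 := Ideal.height_le_card_of_mem_minimalPrimes_span (Set.finite_range f) h
  have h2 : (Set.range f).ncard ≤ n := by
    rw [← Set.image_univ]
    refine (Set.ncard_image_le Set.finite_univ).trans ?_
    simp [Set.ncard_univ]
  have h3 := IsLocalRing.maximalIdeal_height_eq_ringKrullDim (R := R)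
  rw [hx.1] at h3
  have h4 : (maximalIdeal R).height = ((n + 1 : ℕ) : ℕ∞) := by exact_mod_cast h3
  rw [h4] at h1
  have : n + 1 ≤ (Set.range f).ncard := by exact_mod_cast h1
  omega

/-- An element outside the minimal primes over `n` parameters completes them. -/
theorem cons_of_notMem_minimalPrimes [IsNoetherianRing R] {a z : R} {f : Fin n → R}
    (h : IsSystemOfParameters (Fin.cons a f : Fin (n + 1) → R)) (hz : z ∈ maximalIdeal R)
    (hzp : ∀ p ∈ (Ideal.span (Set.range f)).minimalPrimes, z ∉ p) :
    IsSystemOfParameters (Fin.cons z f : Fin (n + 1) → R) := by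
  have hf : ∀ i, f i ∈ maximalIdeal R := fun i => by simpa using h.mem_maximalIdeal i.succ
  have hle : Ideal.span (Set.range (Fin.cons z f : Fin (n + 1) → R)) ≤ maximalIdeal R := by
    rw [Ideal.span_le, Fin.range_cons]
    rintro _ (rfl | ⟨i, rfl⟩)
    · exact hz
    · exact hf i
  refine ⟨h.1, le_antisymm (((Ideal.IsPrime.isRadical inferInstance).radical_le_iff).2 hle) ?_⟩
  rw [Ideal.radical_eq_sInf, le_sInf_iff]
  rintro p ⟨hp, hpp⟩
  by_contra hne
  have hlt : p < maximalIdeal R :=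
    lt_of_le_of_ne (IsLocalRing.le_maximalIdeal hpp.ne_top) fun e => hne e.ge
  rw [Fin.range_cons] at hp
  -- The maximal ideal is minimal over `(a, f)`, so by the principal ideal theorem modulo `f` every
  -- smaller prime containing `f` is minimal over `f`; such primes avoid `z`.
  have hmin : maximalIdeal R ∈ (Ideal.span (insert a (Set.range f))).minimalPrimes := by
    rw [← Fin.range_cons]
    refine ⟨⟨inferInstance, h.span_le⟩, fun q hq _ => ?_⟩
    rw [← h.2]
    exact hq.1.isRadical.radical_le_iff.2 hq.2
  have hpmin := Ideal.mem_minimalPrimes_span_of_mem_minimalPrimes_span_insert hlt a _ hmin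
    (Set.range f) (fun y hy => hp (Ideal.subset_span (Or.inr hy)))
    (fun y hy => Ideal.le_radical (Ideal.subset_span (Or.inr hy)))
  exact hzp p hpmin (hp (Ideal.subset_span (Or.inl rfl)))

/-- Two sets of `n` parameters have a common complement. -/
theorem exists_common_cons [IsNoetherianRing R] {a b : R} {f g : Fin n → R}
    (hf : IsSystemOfParameters (Fin.cons a f : Fin (n + 1) → R))
    (hg : IsSystemOfParameters (Fin.cons b g : Fin (n + 1) → R)) :
    ∃ z : R, IsSystemOfParameters (Fin.cons z f : Fin (n + 1) → R) ∧
      IsSystemOfParameters (Fin.cons z g : Fin (n + 1) → R) := by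
  classical
  let S := ((Ideal.span (Set.range f)).finite_minimalPrimes_of_isNoetherianRing R).toFinset ∪
    ((Ideal.span (Set.range g)).finite_minimalPrimes_of_isNoetherianRing R).toFinset
  have hS : ∀ p, p ∈ S ↔ p ∈ (Ideal.span (Set.range f)).minimalPrimes ∨
      p ∈ (Ideal.span (Set.range g)).minimalPrimes := fun p => by simp [S]
  have hprime : ∀ p ∈ S, p.IsPrime := fun p hp => by
    rcases (hS p).1 hp with h | h <;> exact h.1.1
  have hnot : ¬ ((maximalIdeal R : Set R) ⊆ ⋃ p ∈ (S : Set (Ideal R)), (p : Set R)) := by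
    intro h
    -- The two arguments `⊥` are indices exempt from primality; all members of `S` are prime, so
    -- their choice is immaterial.
    obtain ⟨p, hp, hle⟩ := (Ideal.subset_union_prime (f := fun p : Ideal R => p) ⊥ ⊥
      (fun p hp _ _ => hprime p hp)).1 h
    have := hprime p hp
    have heq : p = maximalIdeal R :=
      le_antisymm (IsLocalRing.le_maximalIdeal this.ne_top) hle
    subst heq
    rcases (hS _).1 hp with h | h
    · exact hf.maximalIdeal_notMem_minimalPrimes f h
    · exact hf.maximalIdeal_notMem_minimalPrimes g h
  obtain ⟨z, hz, hzS⟩ := Set.not_subset.1 hnot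
  have hzS' : ∀ p ∈ S, z ∉ p := by simpa using hzS
  exact ⟨z, hf.cons_of_notMem_minimalPrimes hz fun p hp => hzS' p ((hS p).2 (Or.inl hp)),
    hg.cons_of_notMem_minimalPrimes hz fun p hp => hzS' p ((hS p).2 (Or.inr hp))⟩

end IsSystemOfParameters

/-! ### Closed parameter ideals and regularity. -/

namespace ModuleClosure

variable {c : ModuleClosure R} {n d : ℕ}

/-- Powers of the first parameter keep the ideal closed. -/
theorem StrongColonCapturingA.isClosedIdeal_cons_pow (hscc : c.StrongColonCapturingA)
    {a : R} {f : Fin n → R} (h : IsSystemOfParameters (Fin.cons a f : Fin (n + 1) → R))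
    (hcl : c.IsClosedIdeal (Ideal.span (Set.range (Fin.cons a f : Fin (n + 1) → R)))) (t : ℕ) :
    c.IsClosedIdeal
      (Ideal.span (Set.range (Fin.cons (a ^ (t + 1)) f : Fin (n + 1) → R))) := by
  induction t with
  | zero => simpa using hcl
  | succ t ih =>
    refine le_antisymm (fun u hu => ?_) (c.le_cl _)
    have hmono : Ideal.span (Set.range (Fin.cons (a ^ (t + 1 + 1)) f : Fin (n + 1) → R)) ≤
        Ideal.span (Set.range (Fin.cons (a ^ (t + 1)) f : Fin (n + 1) → R)) := by
      simp only [Fin.range_cons, Ideal.span_insert]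
      exact sup_le_sup_right ((Ideal.span_singleton_le_span_singleton).2 (pow_dvd_pow a (by omega))) _
    have hu' := c.cl_mono _ _ hmono hu
    rw [ih] at hu'
    rw [Fin.range_cons, Ideal.mem_span_insert] at hu'
    obtain ⟨v, i, hi, rfl⟩ := hu'
    have hle : Ideal.span (Set.range f) ≤
        Ideal.span (Set.range (Fin.cons (a ^ (t + 1 + 1)) f : Fin (n + 1) → R)) := by
      rw [Fin.range_cons]
      exact Ideal.span_mono (Set.subset_insert _ _)
    have hv : v * a ^ (t + 1) ∈
        c.cl (M := R) (Ideal.span (Set.range (Fin.cons (a ^ (t + 1 + 1)) f : Fin (n + 1) → R))) := by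
      simpa using Submodule.sub_mem _ hu (c.le_cl _ (hle hi))
    -- The exponents differ by one, so the colon lands in the closure of the original ideal `(a,
    -- f)`, which is closed.
    have hcolon := hscc n _ h.isPartial (t + 1) (t + 1 + 1) (by omega)
    simp only [Fin.cons_zero, Fin.update_cons_zero, Nat.add_sub_cancel_left, pow_one] at hcolon
    have hv' : v ∈ c.cl (M := R)
        (Ideal.span (Set.range (Fin.cons a f : Fin (n + 1) → R))) := by
      apply hcolon
      rw [Submodule.mem_colon_singleton]
      exact hv
    rw [hcl, Fin.range_cons, Ideal.mem_span_insert] at hv'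
    obtain ⟨w, j, hj, rfl⟩ := hv'
    have : (w * a + j) * a ^ (t + 1) + i = w * a ^ (t + 1 + 1) + (j * a ^ (t + 1) + i) := by ring
    rw [this, Fin.range_cons, Ideal.mem_span_insert]
    exact ⟨w, _, Ideal.add_mem _ (Ideal.mul_mem_right _ _ hj) hi, rfl⟩

/-- If `(a, f)` is closed, then every element completing `f` to a system of parameters is
regular modulo `f`. -/
theorem mem_span_of_mul_mem_span [IsNoetherianRing R] (hcc : c.ColonCapturing)
    (hscc : c.StrongColonCapturingA) {a w u : R} {f : Fin n → R}
    (h : IsSystemOfParameters (Fin.cons a f : Fin (n + 1) → R))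
    (hcl : c.IsClosedIdeal (Ideal.span (Set.range (Fin.cons a f : Fin (n + 1) → R))))
    (hw : IsSystemOfParameters (Fin.cons w f : Fin (n + 1) → R))
    (hu : u * w ∈ Ideal.span (Set.range f)) : u ∈ Ideal.span (Set.range f) := by
  -- Colon-capturing divides by the last parameter, so `w` is moved to the end.
  have hsnoc : IsSystemOfParameters (Fin.snoc f w : Fin (n + 1) → R) :=
    hw.of_range_eq (by rw [Fin.range_snoc, Fin.range_cons])
  have hcolon := hcc n _ hsnoc.isPartial
  simp only [Fin.snoc_castSucc, Fin.snoc_last] at hcolon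
  have hu' := hcolon (Submodule.mem_colon_singleton.2 hu)
  refine mem_of_forall_mem_sup_maximalIdeal_pow fun t => ?_
  have hle : Ideal.span (Set.range f) ≤
      Ideal.span (Set.range (Fin.cons (a ^ (t + 1)) f : Fin (n + 1) → R)) := by
    rw [Fin.range_cons]
    exact Ideal.span_mono (Set.subset_insert _ _)
  have hu'' := c.cl_mono _ _ hle hu'
  rw [hscc.isClosedIdeal_cons_pow h hcl t, Fin.range_cons, Ideal.span_insert, sup_comm] at hu''
  refine (sup_le_sup_left ?_ (Ideal.span (Set.range f)) :
    _ ≤ Ideal.span (Set.range f) ⊔ maximalIdeal R ^ t) hu''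
  rw [Ideal.span_singleton_le_iff_mem]
  have ha : a ∈ maximalIdeal R := by simpa using h.mem_maximalIdeal 0
  exact Ideal.pow_le_pow_right (Nat.le_succ t) (Ideal.pow_mem_pow ha _)

/-- Closedness passes from `(a, f)` to `(z, f)`. -/
theorem isClosedIdeal_cons_exchange [IsNoetherianRing R] (hfun : c.IsFunctorial)
    (hcc : c.ColonCapturing) (hscc : c.StrongColonCapturingA) {a z : R} {f : Fin n → R}
    (h : IsSystemOfParameters (Fin.cons a f : Fin (n + 1) → R))
    (hcl : c.IsClosedIdeal (Ideal.span (Set.range (Fin.cons a f : Fin (n + 1) → R))))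
    (hz : IsSystemOfParameters (Fin.cons z f : Fin (n + 1) → R)) :
    c.IsClosedIdeal (Ideal.span (Set.range (Fin.cons z f : Fin (n + 1) → R))) := by
  have ha : a ∈ maximalIdeal R := by simpa using h.mem_maximalIdeal 0
  have har := ha
  rw [← hz.2] at har
  obtain ⟨s, hs⟩ := har
  have hs' : a ^ (s + 1) ∈ Ideal.span (Set.range (Fin.cons z f : Fin (n + 1) → R)) := by
    rw [pow_succ]
    exact Ideal.mul_mem_right _ _ hs
  rw [Fin.range_cons, Ideal.mem_span_insert] at hs'
  obtain ⟨w, i, hi, hwi⟩ := hs'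
  have hcls := hscc.isClosedIdeal_cons_pow h hcl s
  -- Either `w` is a unit, or `a ^ (s + 1) ∈ (w, f)` makes `(w, f)` a system of parameters and the
  -- previous lemma applies.
  have hreg : ∀ v, v * w ∈ Ideal.span (Set.range f) → v ∈ Ideal.span (Set.range f) := by
    intro v hv
    by_cases hwm : w ∈ maximalIdeal R
    · refine mem_span_of_mul_mem_span hcc hscc h hcl (h.of_mem_radical (y := Fin.cons w f) ?_ ?_) hv
      · refine Fin.cases (by simpa using hwm) fun j => ?_
        simpa using h.mem_maximalIdeal j.succ
      · refine Fin.cases ⟨s + 1, ?_⟩ fun j => Ideal.le_radical ?_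
        · rw [Fin.cons_zero, hwi, Fin.range_cons, Ideal.mem_span_insert]
          exact ⟨z, i, hi, by ring⟩
        · rw [Fin.cons_succ]
          exact Ideal.subset_span ⟨j.succ, by simp⟩
    · have hwu : IsUnit w := by simpa [IsLocalRing.mem_maximalIdeal] using hwm
      obtain ⟨w', hw'⟩ := hwu.exists_right_inv
      have := Ideal.mul_mem_right w' _ hv
      rwa [mul_assoc, hw', mul_one] at this
  refine le_antisymm (fun u hu => ?_) (c.le_cl _)
  have h1 : w * u ∈ c.cl (M := R)
      (Ideal.span (Set.range (Fin.cons (a ^ (s + 1)) f : Fin (n + 1) → R))) := by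
    have h2 := hfun R R (LinearMap.mulLeft R w) _ ⟨u, hu, rfl⟩
    refine c.cl_mono _ _ ?_ h2
    rw [Submodule.map_le_iff_le_comap]
    refine Submodule.span_le.2 ?_
    have hle : ∀ v ∈ Ideal.span (Set.range f), v ∈
        Ideal.span (Set.range (Fin.cons (a ^ (s + 1)) f : Fin (n + 1) → R)) := fun v hv => by
      rw [Fin.range_cons]
      exact Ideal.span_mono (Set.subset_insert _ _) hv
    rw [Fin.range_cons]
    rintro v (rfl | ⟨j, rfl⟩)
    · change w * v ∈ Ideal.span (Set.range (Fin.cons (a ^ (s + 1)) f : Fin (n + 1) → R))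
      have : w * v = a ^ (s + 1) - i := by rw [hwi]; ring
      rw [this]
      exact Ideal.sub_mem _ (Ideal.subset_span ⟨0, by simp⟩) (hle _ hi)
    · exact Ideal.mul_mem_left _ _ (hle _ (Ideal.subset_span ⟨j, rfl⟩))
  rw [hcls, Fin.range_cons, Ideal.mem_span_insert] at h1
  obtain ⟨b, k, hk, hbk⟩ := h1
  have h3 : u - b * z ∈ Ideal.span (Set.range f) := by
    refine hreg _ ?_
    have : (u - b * z) * w = b * i + k := by
      have : (u - b * z) * w = w * u - b * (w * z) := by ring
      rw [this, hbk, hwi]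
      ring
    rw [this]
    exact Ideal.add_mem _ (Ideal.mul_mem_left _ _ hi) hk
  rw [Fin.range_cons, Ideal.mem_span_insert]
  exact ⟨b, _, h3, by ring⟩

/-- If one system of parameters generates a closed ideal, then all do. -/
theorem isClosedIdeal_of_isSystemOfParameters [IsNoetherianRing R] (hfun : c.IsFunctorial)
    (hcc : c.ColonCapturing) (hscc : c.StrongColonCapturingA) {x y : Fin d → R}
    (hx : IsSystemOfParameters x) (hxcl : c.IsClosedIdeal (Ideal.span (Set.range x)))
    (hy : IsSystemOfParameters y) : c.IsClosedIdeal (Ideal.span (Set.range y)) := by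
  classical
  -- Induction on a set `S` of positions outside which `x` and `y` agree.
  suffices H : ∀ (S : Finset (Fin d)) (x y : Fin d → R), IsSystemOfParameters x →
      IsSystemOfParameters y → (∀ i ∉ S, x i = y i) →
      c.IsClosedIdeal (Ideal.span (Set.range x)) → c.IsClosedIdeal (Ideal.span (Set.range y)) from
    H Finset.univ x y hx hy (by simp) hxcl
  intro S
  induction S using Finset.induction_on with
  | empty =>
    intro x y _ _ hxy hcl
    rwa [← funext fun i => hxy i (by simp)]
  | insert j S hj ih =>
    intro x y hx hy hxy hcl
    cases d with
    | zero => exact j.elim0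
    | succ n =>
      have hr : ∀ (x : Fin (n + 1) → R) (z : R), Set.range (Function.update x j z) =
          Set.range (Fin.cons z (j.removeNth x) : Fin (n + 1) → R) := fun x z => by
        rw [← Fin.insertNth_removeNth,  Fin.range_insertNth, Fin.range_cons]
        rfl
      have hr' : ∀ x : Fin (n + 1) → R, Set.range x =
          Set.range (Fin.cons (x j) (j.removeNth x) : Fin (n + 1) → R) := fun x => by
        rw [← hr, Function.update_eq_self]
      have hx' := hx.of_range_eq (hr' x).symm
      have hy' := hy.of_range_eq (hr' y).symm
      -- Putting the same `z` at position `j` in both systems leaves them different only within `S`: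
      -- exchange `x j` for `z`, apply induction, then exchange `z` for `y j`.
      obtain ⟨z, hzx, hzy⟩ := hx'.exists_common_cons hy'
      rw [hr' x] at hcl
      have h1 := isClosedIdeal_cons_exchange hfun hcc hscc hx' hcl hzx
      rw [← hr x] at h1
      have h2 := ih _ _ (hzx.of_range_eq (hr x z)) (hzy.of_range_eq (hr y z)) (fun i hi => ?_) h1
      · rw [hr] at h2
        have h3 := isClosedIdeal_cons_exchange hfun hcc hscc hzy h2 hy'
        rwa [← hr'] at h3
      · by_cases hij : i = j
        · subst hij; simp
        · simp [hij, hxy i (by simp [hij, hi])]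

/-- If all systems of parameters generate closed ideals, then colon-capturing makes every system
of parameters a regular sequence. -/
theorem ColonCapturing.isWeaklyRegular [IsNoetherianRing R] (hcc : c.ColonCapturing)
    (hcl : ∀ y : Fin d → R, IsSystemOfParameters y → c.IsClosedIdeal (Ideal.span (Set.range y)))
    {y : Fin d → R} (hy : IsSystemOfParameters y) :
    RingTheory.Sequence.IsWeaklyRegular R (List.ofFn y) := by
  rw [RingTheory.Sequence.isWeaklyRegular_iff_Fin]
  rintro ⟨i, hi⟩
  have hid : i < d := by simpa using hi
  let f : Fin i → R := fun j => y (Fin.castLE hid.le j)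
  have hI : Ideal.ofList ((List.ofFn y).take i) = Ideal.span (Set.range f) := by
    rw [Ideal.ofList]
    congr 1
    ext r
    constructor
    · intro hr
      obtain ⟨k, hk, rfl⟩ := List.mem_take_iff_getElem.1 hr
      exact ⟨⟨k, by omega⟩, by simp [f]⟩
    · rintro ⟨⟨k, hk⟩, rfl⟩
      refine List.mem_take_iff_getElem.2 ⟨k, by simp; omega, ?_⟩
      simp [f]
  have hcol : ∀ u, u * y ⟨i, hid⟩ ∈ Ideal.span (Set.range f) →
      u ∈ Ideal.span (Set.range f) := by
    intro u hu
    have hpart : IsPartialSystemOfParameters fun j : Fin (i + 1) => y (Fin.castLE hid j) :=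
      ⟨d, hid, y, hy, fun _ => rfl⟩
    have h1 := hcc i _ hpart (Submodule.mem_colon_singleton.2 hu)
    refine mem_of_forall_mem_sup_maximalIdeal_pow fun t => ?_
    -- The first `i` parameters stay and the others are raised to the power `t + 1`: a closed ideal
    -- that contains `(f)` and equals it modulo `𝔪^t`.
    let e : Fin d → ℕ := fun j => if j < i then 1 else t + 1
    have he := hy.pow e (fun j => by simp only [e]; split <;> omega)
    have hle : Ideal.span (Set.range f) ≤ Ideal.span (Set.range fun j => y j ^ e j) := by
      refine Ideal.span_mono ?_
      rintro _ ⟨j, rfl⟩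
      exact ⟨Fin.castLE hid.le j, by simp [e, f]⟩
    have h2 := c.cl_mono _ _ hle h1
    rw [hcl _ he] at h2
    refine (Ideal.span_le.2 ?_) h2
    rintro _ ⟨j, rfl⟩
    by_cases hj : j < i
    · refine Ideal.mem_sup_left (Ideal.subset_span ⟨⟨j, hj⟩, ?_⟩)
      simp [e, f, hj]
    · refine Ideal.mem_sup_right ?_
      simp only [e, if_neg hj]
      exact Ideal.pow_le_pow_right (Nat.le_succ t) (Ideal.pow_mem_pow (hy.mem_maximalIdeal j) _)
  rw [isSMulRegular_iff_right_eq_zero_of_smul]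
  intro q hq
  obtain ⟨u, rfl⟩ := Submodule.Quotient.mk_surjective _ q
  rw [← Submodule.Quotient.mk_smul, Submodule.Quotient.mk_eq_zero, smul_eq_mul,
    Ideal.mul_top, hI] at hq
  rw [Submodule.Quotient.mk_eq_zero, smul_eq_mul, Ideal.mul_top, hI]
  refine hcol u ?_
  rw [mul_comm]
  simpa using hq

end ModuleClosure

end SystemsOfParameters

/-! ### Comparison of the derived functor `Ext` with `Abelian.Ext`. -/

section ExtComparison

open CategoryTheory Limits Opposite

variable {R : Type u} [CommRing R]

namespace CategoryTheory.ProjectiveResolution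

variable {M M' : ModuleCat.{u} R} (P : ProjectiveResolution M) (N : ModuleCat.{u} R) (n : ℕ)

theorem smul_extMk {N : ModuleCat.{u} R} {n : ℕ} (r : R) (f : P.complex.X n ⟶ N) (m : ℕ)
    (hm : n + 1 = m) (hf : P.complex.d m n ≫ f = 0) :
    r • P.extMk f m hm hf = P.extMk (r • f) m hm (by rw [Linear.comp_smul, hf, smul_zero]) := by
  rw [Abelian.Ext.smul_eq_comp_mk₀, extMk_comp_mk₀]
  congr 1

/-- A projective resolution has nothing in cochain degree `1`, so there are no nonzero coboundaries
in degree `0`. -/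
theorem extMk_zero_eq_zero_iff {N : ModuleCat.{u} R} (f : P.complex.X 0 ⟶ N) (m : ℕ)
    (hm : 0 + 1 = m) (hf : P.complex.d m 0 ≫ f = 0) : P.extMk f m hm hf = 0 ↔ f = 0 := by
  refine ⟨fun h => ?_, fun h => by subst h; exact P.extMk_zero m hm⟩
  rw [← P.extEquivCohomologyClass.apply_eq_iff_eq, extEquivCohomologyClass_extMk,
    extEquivCohomologyClass_zero, CochainComplex.HomComplex.CohomologyClass.mk_eq_zero_iff,
    CochainComplex.HomComplex.Cocycle.toSingleMk_mem_coboundaries_iff _ _ _ _ _ 1 (by simp)] at h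
  obtain ⟨g, hg⟩ := h
  have h0 : IsZero (P.cochainComplex.X 1) :=
    P.cochainComplex.isZero_of_isStrictlyLE 0 1 (by simp)
  rw [h0.eq_of_src g 0, comp_zero] at hg
  exact (cancel_epi (P.cochainComplexXIso (-(0 : ℕ)) 0 rfl).hom).1 (by rw [← hg, comp_zero])

/-- The complex `Hom(P, N)`, as a complex in the opposite category. -/
noncomputable abbrev homComplexOp : ChainComplex (ModuleCat.{u} R)ᵒᵖ ℕ :=
  (((linearYoneda R (ModuleCat.{u} R)).obj N).rightOp.mapHomologicalComplex _).obj P.complex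

/-- The module of cocycles of degree `n` in `Hom(P, N)`. -/
noncomputable abbrev homCocycles : ModuleCat.{u} R := ((P.homComplexOp N).opcycles n).unop

/-- The inclusion of the cocycles into `Hom(P_n, N)`. -/
noncomputable def homCocyclesι : P.homCocycles N n ⟶ ModuleCat.of R (P.complex.X n ⟶ N) :=
  ((P.homComplexOp N).pOpcycles n).unop

/-- The derived functor `Ext` is the cohomology of `Hom(P, N)`. -/
noncomputable def extIsoHomology :
    ((_root_.Ext R (ModuleCat.{u} R) n).obj (op M)).obj N ≅
      ((P.homComplexOp N).homology n).unop :=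
  (P.isoLeftDerivedObj ((linearYoneda R (ModuleCat.{u} R)).obj N).rightOp n).unop.symm

/-- The class of a cocycle in the derived functor `Ext`. -/
noncomputable def homCocyclesπ :
    P.homCocycles N n ⟶ ((_root_.Ext R (ModuleCat.{u} R) n).obj (op M)).obj N :=
  ((P.homComplexOp N).homologyι n).unop ≫ (P.extIsoHomology N n).inv

instance : Mono (P.homCocyclesι N n) := by
  have : Epi ((P.homComplexOp N).pOpcycles n) := inferInstance
  exact unop_mono_of_epi _

instance : Epi (P.homCocyclesπ N n) := by
  have : Mono ((P.homComplexOp N).homologyι n) := inferInstance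
  have : Epi ((P.homComplexOp N).homologyι n).unop := unop_epi_of_mono _
  exact epi_comp _ _

theorem d_comp_homCocyclesι (m : ℕ) (z : P.homCocycles N n) :
    P.complex.d m n ≫ (P.homCocyclesι N n).hom z = 0 := by
  have h := congrArg Quiver.Hom.unop ((P.homComplexOp N).d_pOpcycles m n)
  exact congrArg (fun f => f.hom z) h

/-- An element of a module is a map from `R`. The opposite of the map `1 ↦ f` kills the
differential, so it descends to the opcycles; the cocycle is the value at `1` of the resulting map.
-/
theorem exists_homCocyclesι_eq (f : P.complex.X n ⟶ N) (hf : P.complex.d (n + 1) n ≫ f = 0) :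
    ∃ z : P.homCocycles N n, (P.homCocyclesι N n).hom z = f := by
  let g : ModuleCat.of R R ⟶ ModuleCat.of R (P.complex.X n ⟶ N) :=
    ModuleCat.ofHom (LinearMap.toSpanSingleton R _ f)
  let k : (P.homComplexOp N).X n ⟶ op (ModuleCat.of R R) := g.op
  have hk : (P.homComplexOp N).d (n + 1) n ≫ k = 0 := by
    apply Quiver.Hom.unop_inj
    ext
    change P.complex.d (n + 1) n ≫ ((1 : R) • f) = 0
    rw [one_smul, hf]
  let l := (P.homComplexOp N).descOpcycles k (n + 1) (by simp) hk
  have hl : (P.homComplexOp N).pOpcycles n ≫ l = k := (P.homComplexOp N).p_descOpcycles _ _ _ _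
  refine ⟨l.unop.hom (1 : R), ?_⟩
  have := congrArg (fun q : (P.homComplexOp N).X n ⟶ op (ModuleCat.of R R) =>
    q.unop.hom (1 : R)) hl
  refine this.trans ?_
  change (1 : R) • f = f
  rw [one_smul]

/-- In the opposite category the homology is the kernel of `fromOpcycles`; dualizing makes it the
cocycles modulo the image of the differential. -/
theorem homCocyclesπ_eq_zero_iff (z : P.homCocycles N n) (j : ℕ)
    (hj : (ComplexShape.down ℕ).next n = j) :
    (P.homCocyclesπ N n).hom z = 0 ↔
      ∃ g : P.complex.X j ⟶ N, P.complex.d n j ≫ g = (P.homCocyclesι N n).hom z := by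
  have hex : (ShortComplex.mk _ _
      ((P.homComplexOp N).homologyι_comp_fromOpcycles n j)).Exact :=
    ShortComplex.exact_of_f_is_kernel _ ((P.homComplexOp N).homologyIsKernel n j hj)
  have hex' := hex.unop
  rw [ShortComplex.moduleCat_exact_iff] at hex'
  have hcomp : ((P.homComplexOp N).fromOpcycles n j).unop ≫ P.homCocyclesι N n =
      ((P.homComplexOp N).d n j).unop :=
    congrArg Quiver.Hom.unop ((P.homComplexOp N).p_fromOpcycles n j)
  have hcomp' : ∀ g : P.complex.X j ⟶ N, (P.homCocyclesι N n).hom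
      (((P.homComplexOp N).fromOpcycles n j).unop.hom g) = P.complex.d n j ≫ g := fun g =>
    congrArg (fun f => f.hom g) hcomp
  have hinj : Function.Injective (P.homCocyclesι N n).hom :=
    (ModuleCat.mono_iff_injective _).1 inferInstance
  have hiso : Function.Injective (P.extIsoHomology N n).inv.hom :=
    (ModuleCat.mono_iff_injective _).1 inferInstance
  constructor
  · intro h
    have h1 : ((P.homComplexOp N).homologyι n).unop.hom z = 0 :=
      hiso (h.trans (map_zero _).symm)
    obtain ⟨g, hg⟩ := hex' z h1
    exact ⟨g, (hcomp' g).symm.trans (congrArg (P.homCocyclesι N n).hom hg)⟩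
  · rintro ⟨g, hg⟩
    have hz : z = ((P.homComplexOp N).fromOpcycles n j).unop.hom g :=
      hinj (by rw [hcomp' g, hg])
    have h0 : ((P.homComplexOp N).fromOpcycles n j).unop ≫
        ((P.homComplexOp N).homologyι n).unop = 0 :=
      congrArg Quiver.Hom.unop ((P.homComplexOp N).homologyι_comp_fromOpcycles n j)
    have h1 : ((P.homComplexOp N).homologyι n).unop.hom z = 0 := by
      rw [hz]
      exact congrArg (fun f => f.hom g) h0
    exact (congrArg (P.extIsoHomology N n).inv.hom h1).trans (map_zero _)

/-- The class of a cocycle in `Abelian.Ext`. -/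
noncomputable def homCocyclesExt : P.homCocycles N n →ₗ[R] Abelian.Ext M N n where
  toFun z := P.extMk ((P.homCocyclesι N n).hom z) (n + 1) rfl (P.d_comp_homCocyclesι N n _ z)
  map_add' z w := by
    rw [add_extMk]
    congr 1
    exact map_add _ _ _
  map_smul' r z := by
    rw [RingHom.id_apply, smul_extMk]
    congr 1
    exact map_smul _ _ _

theorem homCocyclesExt_surjective : Function.Surjective (P.homCocyclesExt N n) := by
  intro α
  obtain ⟨f, hf, rfl⟩ := P.extMk_surjective α (n + 1) rfl
  obtain ⟨z, rfl⟩ := P.exists_homCocyclesι_eq N n f hf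
  exact ⟨z, rfl⟩

/-- Both classes vanish exactly on coboundaries, so both versions of `Ext` are the same quotient of
the cocycles. -/
theorem ker_homCocyclesExt :
    LinearMap.ker (P.homCocyclesExt N n) = LinearMap.ker (P.homCocyclesπ N n).hom := by
  ext z
  rw [LinearMap.mem_ker, LinearMap.mem_ker]
  cases n with
  | zero =>
    -- Nothing follows degree `0`, so `next 0` defaults to `0`, and the differential from `0` to `0`
    -- is zero.
    rw [P.homCocyclesπ_eq_zero_iff N 0 z 0 (by simp)]
    refine (P.extMk_zero_eq_zero_iff _ _ rfl (P.d_comp_homCocyclesι N 0 _ z)).trans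
      ⟨fun h => ⟨0, by rw [h, comp_zero]⟩, ?_⟩
    rintro ⟨g, hg⟩
    rw [← hg, P.complex.shape _ _ (by simp), zero_comp]
  | succ n =>
    rw [P.homCocyclesπ_eq_zero_iff N (n + 1) z n (by simp)]
    exact P.extMk_eq_zero_iff _ _ rfl (P.d_comp_homCocyclesι N (n + 1) _ z) n rfl

/-- The derived functor `Ext` agrees with `Abelian.Ext`. -/
noncomputable def extLinearEquiv :
    ((_root_.Ext R (ModuleCat.{u} R) n).obj (op M)).obj N ≃ₗ[R] Abelian.Ext M N n :=
  (LinearMap.quotKerEquivOfSurjective (P.homCocyclesπ N n).hom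
    ((ModuleCat.epi_iff_surjective _).1 inferInstance)).symm ≪≫ₗ
  Submodule.quotEquivOfEq _ _ (P.ker_homCocyclesExt N n).symm ≪≫ₗ
  LinearMap.quotKerEquivOfSurjective _ (P.homCocyclesExt_surjective N n)

theorem extLinearEquiv_homCocyclesπ (z : P.homCocycles N n) :
    P.extLinearEquiv N n ((P.homCocyclesπ N n).hom z) = P.homCocyclesExt N n z := by
  have : (LinearMap.quotKerEquivOfSurjective (P.homCocyclesπ N n).hom
    ((ModuleCat.epi_iff_surjective _).1 inferInstance)).symm ((P.homCocyclesπ N n).hom z) =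
      Submodule.Quotient.mk z := by
    rw [LinearEquiv.symm_apply_eq]
    rfl
  simp only [extLinearEquiv, LinearEquiv.trans_apply, this]
  rfl

/-- The comparison of the two versions of `Ext` is natural in the first variable. -/
theorem extLinearEquiv_naturality (P' : ProjectiveResolution M') (g : M' ⟶ M)
    (e : ((_root_.Ext R (ModuleCat.{u} R) n).obj (op M)).obj N) :
    P'.extLinearEquiv N n ((((_root_.Ext R (ModuleCat.{u} R) n).map g.op).app N).hom e) =
      (Abelian.Ext.mk₀ g).comp (P.extLinearEquiv N n e) (zero_add n) := by
  have hφ : (lift g P' P).f 0 ≫ P.π.f 0 = P'.π.f 0 ≫ g := lift_commutes_zero g P' P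
  let φ : Hom P' P g := ⟨lift g P' P, hφ⟩
  obtain ⟨z, rfl⟩ := (ModuleCat.epi_iff_surjective (P.homCocyclesπ N n)).1 inferInstance e
  let F := ((linearYoneda R (ModuleCat.{u} R)).obj N).rightOp
  let ψ : P'.homComplexOp N ⟶ P.homComplexOp N := (F.mapHomologicalComplex _).map φ.hom
  let z' : P'.homCocycles N n := (HomologicalComplex.opcyclesMap ψ n).unop.hom z
  have hz' : (P'.homCocyclesι N n).hom z' = φ.hom.f n ≫ (P.homCocyclesι N n).hom z := by
    have h := congrArg Quiver.Hom.unop (HomologicalComplex.p_opcyclesMap ψ n)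
    exact congrArg (fun f => f.hom z) h
  -- Naturality of the derived functor along the lift `φ` of `g` to the resolutions, read off in the
  -- opposite category.
  have hπ : (P'.homCocyclesπ N n).hom z' =
      (((_root_.Ext R (ModuleCat.{u} R) n).map g.op).app N).hom ((P.homCocyclesπ N n).hom z) := by
    have h1 : (F.leftDerived n).map g ≫ (P.extIsoHomology N n).inv.op =
        (P'.extIsoHomology N n).inv.op ≫ HomologicalComplex.homologyMap ψ n :=
      isoLeftDerivedObj_hom_naturality g P' P φ.hom hφ F n
    have h2 := HomologicalComplex.homologyι_naturality ψ n
    have h3 : (P'.extIsoHomology N n).inv.op ≫ (P'.homComplexOp N).homologyι n ≫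
        HomologicalComplex.opcyclesMap ψ n =
        (F.leftDerived n).map g ≫ (P.extIsoHomology N n).inv.op ≫
          (P.homComplexOp N).homologyι n := by
      rw [← h2, ← Category.assoc, ← h1]
      exact Category.assoc _ _ _
    exact congrArg (fun f => f.hom z) (congrArg Quiver.Hom.unop h3)
  rw [← hπ, extLinearEquiv_homCocyclesπ, extLinearEquiv_homCocyclesπ]
  refine Eq.trans ?_ (mk₀_comp_extMk ((P.homCocyclesι N n).hom z) (n + 1) rfl
    (P.d_comp_homCocyclesι N n _ z) φ).symm
  simp only [← hz']
  rfl

end CategoryTheory.ProjectiveResolution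

end ExtComparison

/-! ### Dimension shifting along regular sequences. -/

section ReesIsomorphism

open CategoryTheory Limits RingTheory.Sequence Pointwise

variable {R : Type u} [CommRing R]

namespace ModuleCat

variable {M M' N : ModuleCat.{u} R} {n : ℕ}

theorem smul_ext_eq_zero_of_mem_annihilator {r : R} (hr : r ∈ Module.annihilator R M)
    (α : Abelian.Ext M N n) : r • α = 0 := by
  have h : r • 𝟙 M = 0 := by
    simp [← ModuleCat.lsmul_eq_smul_id, Module.mem_annihilator_iff_lsmul_eq_zero.mp hr]
  have h2 : r • α = (Abelian.Ext.mk₀ (r • 𝟙 M)).comp α (zero_add n) := by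
    simp [Abelian.Ext.mk₀_smul]
  rw [h2, h, Abelian.Ext.mk₀_zero, Abelian.Ext.zero_comp]

/-- Multiplication by `r` on `N` acts on `Ext` as the scalar `r`, which already vanishes through
`M`. Hence every class lifts along the connecting map from `Ext(M, N/rN)` in one degree lower. -/
theorem comp_mk₀_smulShortComplex_f_eq_zero {r : R} (hr : r ∈ Module.annihilator R M)
    (α : Abelian.Ext M N n) :
    α.comp (Abelian.Ext.mk₀ (N.smulShortComplex r).f) (add_zero n) = 0 := by
  have h : α.comp (Abelian.Ext.mk₀ (N.smulShortComplex r).f) (add_zero n) = r • α :=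
    (Abelian.Ext.smul_eq_comp_mk₀ α r).symm
  exact h.trans (smul_ext_eq_zero_of_mem_annihilator hr α)

/-- `Ext^i(M, N) = 0` below the length of an `N`-regular sequence killing `M`. -/
theorem ext_eq_zero_of_isWeaklyRegular (rs : List R) (hN : IsWeaklyRegular N rs)
    (hM : ∀ r ∈ rs, r ∈ Module.annihilator R M) (i : ℕ) (hi : i < rs.length)
    (α : Abelian.Ext M N i) : α = 0 := by
  induction rs generalizing N i with
  | nil => simp at hi
  | cons a rs ih =>
    rw [isWeaklyRegular_cons_iff] at hN
    have hα := comp_mk₀_smulShortComplex_f_eq_zero (hM a (by simp)) α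
    have hS := hN.1.smulShortComplex_shortExact
    cases i with
    | zero =>
      have := hS.mono_f
      exact Abelian.Ext.postcomp_mk₀_injective_of_mono M (N.smulShortComplex a).f
        (hα.trans (map_zero ((Abelian.Ext.mk₀ (N.smulShortComplex a).f).postcomp M
          (add_zero 0))).symm)
    | succ i =>
      obtain ⟨β, rfl⟩ := Abelian.Ext.covariant_sequence_exact₁ M hS α hα rfl
      have hβ : β = 0 := ih (N := ModuleCat.of R (QuotSMulTop a N)) hN.2
        (fun r hr => hM r (by simp [hr])) i (by simpa using hi) β
      subst hβ
      exact Abelian.Ext.zero_comp _ _ hS.extClass _ _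

/-- Surjections between modules killed by an `N`-regular sequence of length `n` induce
injections on `Ext^n(-, N)`. -/
theorem eq_zero_of_mk₀_comp_eq_zero (rs : List R) (hN : IsWeaklyRegular N rs)
    (hM : ∀ r ∈ rs, r ∈ Module.annihilator R M) (hM' : ∀ r ∈ rs, r ∈ Module.annihilator R M')
    (g : M' ⟶ M) [Epi g] (α : Abelian.Ext M N rs.length)
    (hα : (Abelian.Ext.mk₀ g).comp α (zero_add _) = 0) : α = 0 := by
  induction rs generalizing N with
  | nil =>
    exact Abelian.Ext.precomp_mk₀_injective_of_epi N g
      (hα.trans (map_zero ((Abelian.Ext.mk₀ g).precomp N (zero_add 0))).symm)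
  | cons a rs ih =>
    rw [isWeaklyRegular_cons_iff] at hN
    have hS := hN.1.smulShortComplex_shortExact
    obtain ⟨β, rfl⟩ := Abelian.Ext.covariant_sequence_exact₁ M hS α
      (comp_mk₀_smulShortComplex_f_eq_zero (hM a (by simp)) α) rfl
    have h1 : ((Abelian.Ext.mk₀ g).comp β (zero_add _)).comp hS.extClass rfl = 0 := by
      rw [Abelian.Ext.comp_assoc _ _ _ (zero_add _) rfl (by omega)]
      exact hα
    -- The connecting map is injective here: its kernel comes from `Ext(M', N)` below the length of
    -- the regular sequence, which vanishes.
    obtain ⟨γ, hγ⟩ := Abelian.Ext.covariant_sequence_exact₃ M' hS _ rfl h1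
    have hγ0 : γ = 0 := ext_eq_zero_of_isWeaklyRegular (a :: rs)
      ((isWeaklyRegular_cons_iff _ _ _).2 hN) hM' _ (by simp) γ
    rw [hγ0, Abelian.Ext.zero_comp] at hγ
    have hβ : β = 0 := ih (N := ModuleCat.of R (QuotSMulTop a N)) hN.2
      (fun r hr => hM r (by simp [hr])) (fun r hr => hM' r (by simp [hr])) β hγ.symm
    subst hβ
    exact Abelian.Ext.zero_comp _ _ hS.extClass _ _

/-- `Ext^n(M, N)` embeds into `Hom(M, N / (x₁, …, xₙ) N)` if `x₁, …, xₙ` is an `N`-regular sequence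
killing `M`. -/
theorem exists_injective_ext_to_hom (rs : List R) (hN : IsWeaklyRegular N rs)
    (hM : ∀ r ∈ rs, r ∈ Module.annihilator R M) :
    ∃ f : Abelian.Ext M N rs.length →ₗ[R] (M →ₗ[R] N ⧸ (Ideal.ofList rs • ⊤ : Submodule R N)),
      Function.Injective f := by
  induction rs generalizing N with
  | nil =>
    have hbot : (Ideal.ofList ([] : List R) • ⊤ : Submodule R N) = ⊥ := by simp
    let e : N ≃ₗ[R] N ⧸ (Ideal.ofList ([] : List R) • ⊤ : Submodule R N) :=
      (Submodule.quotEquivOfEqBot _ hbot).symm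
    let e₀ : Abelian.Ext M N 0 ≃ₗ[R] (M ⟶ N) := Abelian.Ext.linearEquiv₀
    let e₁ : (M ⟶ N) ≃ₗ[R] (M →ₗ[R] N) := ModuleCat.homLinearEquiv
    let e₂ := e₀ ≪≫ₗ e₁ ≪≫ₗ LinearEquiv.congrRight e
    exact ⟨e₂.toLinearMap, e₂.injective⟩
  | cons a rs ih =>
    rw [isWeaklyRegular_cons_iff] at hN
    have hS := hN.1.smulShortComplex_shortExact
    obtain ⟨f, hf⟩ := ih (N := ModuleCat.of R (QuotSMulTop a N)) hN.2
      (fun r hr => hM r (by simp [hr]))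
    let δ : Abelian.Ext M (ModuleCat.of R (QuotSMulTop a N)) rs.length →ₗ[R]
      Abelian.Ext M N (a :: rs).length := Abelian.Ext.postcompOfLinear hS.extClass R M rfl
    -- Injective because the lower `Ext(M, N)` vanishes, surjective because `a` kills `Ext(M, N)`.
    have hδ : Function.Bijective δ := by
      constructor
      · rw [← LinearMap.ker_eq_bot, eq_bot_iff]
        intro β hβ
        obtain ⟨γ, rfl⟩ := Abelian.Ext.covariant_sequence_exact₃ M hS β rfl hβ
        have hγ0 : γ = 0 := ext_eq_zero_of_isWeaklyRegular (a :: rs)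
          ((isWeaklyRegular_cons_iff _ _ _).2 hN) hM _ (by simp) γ
        subst hγ0
        rw [Abelian.Ext.zero_comp]
        exact Submodule.zero_mem _
      · intro α
        exact Abelian.Ext.covariant_sequence_exact₁ M hS α
          (comp_mk₀_smulShortComplex_f_eq_zero (hM a (by simp)) α) rfl
    let q := Submodule.quotOfListConsSMulTopEquivQuotSMulTopInner N a rs
    let eδ := LinearEquiv.ofBijective δ hδ
    exact ⟨(LinearEquiv.congrRight q.symm).toLinearMap ∘ₗ f ∘ₗ eδ.symm.toLinearMap,
      (LinearEquiv.congrRight q.symm).injective.comp (hf.comp eδ.symm.injective)⟩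

end ModuleCat

end ReesIsomorphism

/-! ### Finitely generated submodules of filtered colimits. -/

section FilteredColimits

open CategoryTheory Limits

variable {R : Type u} [CommRing R]

/-- A finitely generated submodule of a filtered colimit along injections embeds into one of the
terms, from some stage on. -/
theorem ModuleCat.exists_injective_of_isColimit {J : Type} [SmallCategory J] [IsFiltered J]
    (F : J ⥤ ModuleCat.{u} R) {c : Cocone F} (hc : IsColimit c)
    (hF : ∀ {i j : J} (f : i ⟶ j), Function.Injective (F.map f).hom)
    (N : Submodule R c.pt) (hN : N.FG) :
    ∃ (j : J) (f : N →ₗ[R] F.obj j), Function.Injective f := by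
  have : PreservesFilteredColimitsOfSize.{0, 0} (forget (ModuleCat.{u} R)) :=
    preservesSmallestFilteredColimits_of_preservesFilteredColimits.{u, u} _
  -- Elements with equal image in the colimit agree after arrows `f` and `g` to a common stage, and
  -- a further arrow equalizes `f` and `g`; injective transition maps then force equality.
  have hι : ∀ j, Function.Injective (c.ι.app j).hom := by
    intro j x y hxy
    obtain ⟨k, f, g, hfg⟩ := Concrete.isColimit_exists_of_rep_eq F hc x y hxy
    obtain ⟨l, h, hl⟩ := IsFilteredOrEmpty.cocone_maps f g
    have h1 : (F.map (f ≫ h)).hom x = (F.map (g ≫ h)).hom y := by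
      simp only [F.map_comp]
      exact congrArg (F.map h).hom hfg
    rw [← hl] at h1
    exact hF _ h1
  have hle : ∀ {i j : J} (f : i ⟶ j),
      LinearMap.range (c.ι.app i).hom ≤ LinearMap.range (c.ι.app j).hom := by
    rintro i j f _ ⟨x, rfl⟩
    exact ⟨(F.map f).hom x, congrArg (fun g => g.hom x) (c.w f)⟩
  obtain ⟨j, hj⟩ : ∃ j, N ≤ LinearMap.range (c.ι.app j).hom := by
    refine Submodule.fg_induction
      (motive := fun N _ => ∃ j, N ≤ LinearMap.range (c.ι.app j).hom) ?_ ?_ N hN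
    · intro x
      obtain ⟨j, y, hy⟩ := Concrete.isColimit_exists_rep F hc x
      exact ⟨j, (Submodule.span_singleton_le_iff_mem _ _).2 ⟨y, hy⟩⟩
    · rintro N₁ N₂ _ _ ⟨j₁, h₁⟩ ⟨j₂, h₂⟩
      exact ⟨IsFiltered.max j₁ j₂, sup_le (h₁.trans (hle (IsFiltered.leftToMax _ _)))
        (h₂.trans (hle (IsFiltered.rightToMax _ _)))⟩
  let e := LinearEquiv.ofInjective (c.ι.app j).hom (hι j)
  exact ⟨j, e.symm.toLinearMap ∘ₗ Submodule.inclusion hj,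
    e.symm.injective.comp (Submodule.inclusion_injective hj)⟩

end FilteredColimits

/-! ### Local cohomology as an increasing union of `Ext` modules. -/

section LocalCohomology

open CategoryTheory Limits Opposite RingTheory.Sequence localCohomology

variable {R : Type u} [CommRing R]

/-- If every power of `J` contains an `R`-regular sequence of length `n`, then the transition maps
of the system `Ext^n(R/J^t, R)` are injective. -/
theorem localCohomology.diagram_map_injective (J : Ideal R) (n : ℕ)
    (hJ : ∀ t : ℕ, ∃ rs : List R, rs.length = n ∧ IsWeaklyRegular R rs ∧ ∀ r ∈ rs, r ∈ J ^ t)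
    {i j : (ℕᵒᵖ)ᵒᵖ} (f : i ⟶ j) :
    Function.Injective
      ((diagram (idealPowersDiagram J) n ⋙
        (evaluation _ _).obj (ModuleCat.of R R)).map f).hom := by
  -- The sequence is taken in the smaller power, that of `j`, so that it kills both quotients.
  obtain ⟨rs, rfl, hreg, hmem⟩ := hJ j.unop.unop
  have hij : J ^ j.unop.unop ≤ J ^ i.unop.unop := ((idealPowersDiagram J).map f.unop).down.down
  let M := (ringModIdeals (idealPowersDiagram J)).obj i.unop
  let M' := (ringModIdeals (idealPowersDiagram J)).obj j.unop
  let g : M' ⟶ M := (ringModIdeals (idealPowersDiagram J)).map f.unop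
  have hg : Epi g := by
    rw [ModuleCat.epi_iff_surjective]
    intro y
    obtain ⟨x, rfl⟩ := Submodule.Quotient.mk_surjective _ y
    exact ⟨Submodule.Quotient.mk x, rfl⟩
  have hann : ∀ t : ℕᵒᵖ, ∀ r ∈ J ^ t.unop, r ∈ Module.annihilator R
      ((ringModIdeals (idealPowersDiagram J)).obj t) := fun t r hr => by
    change r ∈ Module.annihilator R (R ⧸ J ^ t.unop)
    rwa [Ideal.annihilator_quotient]
  let P := ProjectiveResolution.of M
  let P' := ProjectiveResolution.of M'
  rw [← LinearMap.ker_eq_bot, eq_bot_iff]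
  intro e he
  have h1 := P.extLinearEquiv_naturality (ModuleCat.of R R) rs.length P' g e
  have h2 : (((_root_.Ext R (ModuleCat.{u} R) rs.length).map g.op).app (ModuleCat.of R R)).hom e =
    0 := he
  rw [h2, map_zero] at h1
  have h3 := ModuleCat.eq_zero_of_mk₀_comp_eq_zero rs hreg
    (fun r hr => hann i.unop r (hij (hmem r hr))) (fun r hr => hann j.unop r (hmem r hr)) g _
    h1.symm
  exact (LinearEquiv.map_eq_zero_iff _).1 h3

/-- A finitely generated submodule of the local cohomology `H_J^n(R)` embeds into the quotient of
`R` by an `R`-regular sequence of length `n`, if every power of `J` contains one. -/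
theorem localCohomology.exists_injective_to_quotient (J : Ideal R) (n : ℕ) (S : Set (List R))
    (hS : ∀ rs ∈ S, rs.length = n ∧ IsWeaklyRegular R rs)
    (hJ : ∀ t : ℕ, ∃ rs ∈ S, ∀ r ∈ rs, r ∈ J ^ t)
    (N : Submodule R ((localCohomology J n).obj (ModuleCat.of R R))) (hN : N.FG) :
    ∃ rs ∈ S, ∃ f : N →ₗ[R] R ⧸ Ideal.ofList rs, Function.Injective f := by
  have hinj : ∀ {i j : (ℕᵒᵖ)ᵒᵖ} (f : i ⟶ j), Function.Injective
      ((diagram (idealPowersDiagram J) n ⋙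
        (evaluation _ _).obj (ModuleCat.of R R)).map f).hom := fun f =>
    localCohomology.diagram_map_injective J n (fun t => by
      obtain ⟨rs, hrs, h⟩ := hJ t
      exact ⟨rs, (hS rs hrs).1, (hS rs hrs).2, h⟩) f
  have := hasColimitDiagram.{u, 0} (idealPowersDiagram J) n
  -- Colimits of functors are computed pointwise, so the local cohomology of `R` is the colimit of
  -- the modules `Ext^n(R/J^t, R)`.
  have hc := isColimitOfPreserves ((evaluation _ _).obj (ModuleCat.of R R))
    (colimit.isColimit (diagram (idealPowersDiagram J) n))
  obtain ⟨j, f, hf⟩ := ModuleCat.exists_injective_of_isColimit _ hc hinj N hN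
  obtain ⟨rs, hrs, hmem⟩ := hJ j.unop.unop
  obtain ⟨rfl, hreg⟩ := hS rs hrs
  let M := (ringModIdeals (idealPowersDiagram J)).obj j.unop
  have hann : ∀ r ∈ rs, r ∈ Module.annihilator R M := fun r hr => by
    change r ∈ Module.annihilator R (R ⧸ J ^ j.unop.unop)
    rw [Ideal.annihilator_quotient]
    exact hmem r hr
  obtain ⟨g, hg⟩ := ModuleCat.exists_injective_ext_to_hom (N := ModuleCat.of R R) rs hreg hann
  let e := (ProjectiveResolution.of M).extLinearEquiv (ModuleCat.of R R) rs.length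
  let one : M := (Submodule.Quotient.mk 1 : R ⧸ J ^ j.unop.unop)
  -- A map out of the cyclic module `R/J^t` is determined by its value at `1`.
  let ev : (M →ₗ[R] R ⧸ (Ideal.ofList rs • ⊤ : Submodule R R)) →ₗ[R]
    R ⧸ (Ideal.ofList rs • ⊤ : Submodule R R) := LinearMap.applyₗ one
  have hev : Function.Injective ev := by
    intro φ ψ h
    refine LinearMap.ext fun x => ?_
    obtain ⟨r, rfl⟩ := Submodule.Quotient.mk_surjective (J ^ j.unop.unop) x
    have hr : (Submodule.Quotient.mk r : R ⧸ J ^ j.unop.unop) = r • Submodule.Quotient.mk 1 := by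
      rw [← Submodule.Quotient.mk_smul, smul_eq_mul, mul_one]
    rw [hr]
    exact (φ.map_smul r one).trans ((congrArg (r • ·) h).trans (ψ.map_smul r one).symm)
  let q : (R ⧸ (Ideal.ofList rs • ⊤ : Submodule R R)) ≃ₗ[R] R ⧸ Ideal.ofList rs :=
    Submodule.quotEquivOfEq _ _ (by rw [smul_eq_mul, Ideal.mul_top])
  exact ⟨rs, hrs, q.toLinearMap ∘ₗ ev ∘ₗ g ∘ₗ e.toLinearMap ∘ₗ f,
    q.injective.comp (hev.comp (hg.comp (e.injective.comp hf)))⟩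

end LocalCohomology

/-! ### Closure of zero, and rationality. -/

namespace ModuleClosure

variable {R : Type u} [CommRing R] {c : ModuleClosure R}

/-- In the quotient by a closed ideal, zero is closed. -/
theorem IsResidual.cl_bot_quotient (hres : c.IsResidual) {I : Ideal R} (hI : c.IsClosedIdeal I) :
    c.cl (⊥ : Submodule R (R ⧸ I)) = ⊥ := by
  have h := hres R I I le_rfl
  have h0 : Submodule.map (Submodule.mkQ I) I = ⊥ := by simp
  rw [h0] at h
  have hI' : c.cl (M := R) I = I := hI
  rw [eq_bot_iff]
  intro y hy
  obtain ⟨r, rfl⟩ := Submodule.mkQ_surjective I y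
  have hr : r ∈ c.cl (M := R) I := by
    rw [h]
    exact hy
  rw [hI'] at hr
  simpa [Ideal.Quotient.eq_zero_iff_mem] using hr

/-- Zero is closed in every submodule of a module in which zero is closed. -/
theorem IsFunctorial.cl_bot_of_injective (hfun : c.IsFunctorial) {M N : Type u} [AddCommGroup M]
    [Module R M] [AddCommGroup N] [Module R N] (f : M →ₗ[R] N) (hf : Function.Injective f)
    (hN : c.cl (⊥ : Submodule R N) = ⊥) : c.cl (⊥ : Submodule R M) = ⊥ := by
  rw [eq_bot_iff]
  intro x hx
  have h := hfun M N f ⊥ ⟨x, hx, rfl⟩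
  rw [Submodule.map_bot, hN, Submodule.mem_bot] at h
  exact (Submodule.mem_bot R).2 (hf (h.trans (map_zero f).symm))

end ModuleClosure

section Rationality

variable {R : Type u} [CommRing R] [IsLocalRing R] [IsNoetherianRing R] {c : ModuleClosure R}

/-- If all parameter ideals are closed, then zero is closed in every finitely generated submodule
of the top local cohomology. -/
theorem ModuleClosure.cl_bot_of_fg_topLocalCohomology (hfun : c.IsFunctorial)
    (hres : c.IsResidual) (hcc : c.ColonCapturing) {d : ℕ} {x : Fin d → R}
    (hx : IsSystemOfParameters x)
    (hcl : ∀ y : Fin d → R, IsSystemOfParameters y → c.IsClosedIdeal (Ideal.span (Set.range y)))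
    (N : Submodule R (topLocalCohomology R)) (hN : N.FG) : c.cl (⊥ : Submodule R N) = ⊥ := by
  have hd : localDim R = d := by
    rw [localDim, hx.1]
    rfl
  have hspan : ∀ y : Fin d → R, Ideal.ofList (List.ofFn y) = Ideal.span (Set.range y) := by
    intro y
    rw [Ideal.ofList]
    congr 1
    ext r
    simp [List.mem_ofFn]
  obtain ⟨rs, ⟨y, hy, rfl⟩, f, hf⟩ := localCohomology.exists_injective_to_quotient
    (maximalIdeal R) (localDim R)
    {rs | ∃ y : Fin d → R, IsSystemOfParameters y ∧ rs = List.ofFn y}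
    (by
      rintro _ ⟨y, hy, rfl⟩
      exact ⟨by rw [List.length_ofFn, hd], hcc.isWeaklyRegular hcl hy⟩)
    (fun t => by
      -- Powers of `x` give a system of parameters inside `𝔪^t`; the exponent `t + 1` is nonzero
      -- even for `t = 0`.
      refine ⟨_, ⟨_, hx.pow (fun _ => t + 1) (fun _ => t.succ_ne_zero), rfl⟩, fun r hr => ?_⟩
      obtain ⟨i, rfl⟩ := (List.mem_ofFn).1 hr
      exact Ideal.pow_le_pow_right t.le_succ (Ideal.pow_mem_pow (hx.mem_maximalIdeal i) _))
    N hN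
  refine hfun.cl_bot_of_injective f hf (hres.cl_bot_quotient ?_)
  rw [hspan]
  exact hcl y hy

end Rationality

theorem mainTheorem6 {R : Type u} [CommRing R] [IsLocalRing R] [IsNoetherianRing R]
    [IsAdicComplete (maximalIdeal R) R] (hCM : IsCohenMacaulayLocal R)
    (c : ModuleClosure R) (hfun : c.IsFunctorial) (hres : c.IsResidual)
    (hcc : c.ColonCapturing) (hscc : c.StrongColonCapturingA)
    {d : ℕ} (x : Fin d → R) (hx : IsSystemOfParameters x)
    (hxcl : c.IsClosedIdeal (Ideal.span (Set.range x))) :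
    (∀ (n : ℕ) (y : Fin n → R), IsSystemOfParameters y →
      c.IsClosedIdeal (Ideal.span (Set.range y))) ∧
    (c.InjectiveFiniteness → c.IsRational) := by
  have hcl : ∀ y : Fin d → R, IsSystemOfParameters y →
      c.IsClosedIdeal (Ideal.span (Set.range y)) := fun y hy =>
    ModuleClosure.isClosedIdeal_of_isSystemOfParameters hfun hcc hscc hx hxcl hy
  refine ⟨fun n y hy => ?_, fun hfin => ?_⟩
  · obtain rfl : n = d := by
      have h := hy.1.symm.trans hx.1
      exact_mod_cast h
    exact hcl y hy
  · refine eq_top_iff.2 fun f _ h hh => ?_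
    have hh' : h ∈ c.finitistic (⊥ : Submodule R (topLocalCohomology R)) := hfin ▸ hh
    -- Injective finiteness places `h` in the closure of zero in a finitely generated `N`, which is
    -- zero.
    obtain ⟨N, -, hNfin, hN⟩ := hh'
    have hbot : (⊥ : Submodule R (topLocalCohomology R)).submoduleOf N = ⊥ := by
      simp [Submodule.submoduleOf, Submodule.comap_bot]
    rw [hbot] at hNfin hN
    have hNfg : N.FG := Module.Finite.iff_fg.1
      (Module.Finite.equiv (Submodule.quotEquivOfEqBot (⊥ : Submodule R N) rfl))
    rw [ModuleClosure.cl_bot_of_fg_topLocalCohomology hfun hres hcc hx hcl N hNfg,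
      Submodule.map_bot, Submodule.mem_bot] at hN
    rw [hN, map_zero]
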